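/- Let $\Lambda\subseteq[0,\infty)$ be an additive semigroup with $0\in\Lambda$. An \emph{admissible weight} on $\Lambda$ is a function $w\colon\Lambda\to(0,\infty)$ such that $w(0)=1$, $w(\lambda+\lambda')\le w(\lambda)\,w(\lambda')$ for all $\lambda,\lambda'\in\Lambda$, $w(\lambda)\ge 1$ for all $\lambda\in\Lambda$, and $\lim_{k\to\infty}w(k\lambda)^{1/k}=1$ for every $\lambda\in\Lambda$. For such $w$ let $\mathscr{A}_w$ be the set of all functions $a\colon\Lambda\to\mathbb{C}$ with $\sum_{\lambda\in\Lambda}|a(\lambda)|\,w(\lambda)<\infty$. Let $\mathbb{H}=\{s\in\mathbb{C}:\operatorname{Re}s>0\}$, and for $a\in\mathscr{A}_w$ let $\widetilde{a}(s)=\sum_{\lambda\in\Lambda}a(\lambda)e^{-\lambda s}$ for $s\in\overline{\mathbb{H}}$. Let $f$ be a holomorphic function defined on a region (a non-empty connected open set) $G\subseteq\mathbb{C}$, let $w$ be an admissible weight on $\Lambda$, and suppose that $a\in\mathscr{A}_w$ satisfies $\overline{\widetilde{a}(\mathbb{H})}\subseteq G$. Then there exists $c\in\mathscr{A}_w$ such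 that $f(\widetilde{a}(s))=\widetilde{c}(s)$ for all $s\in\overline{\mathbb{H}}$. -/

import Mathlib

namespace GeneralDirichlet

/-- A weight function on a commutative semigroup `M` with neutral element `0`: a positive,
submultiplicative function that is normalised by `w 0 = 1`. -/
structure IsWeight {M : Type*} [AddCommMonoid M] (w : M → ℝ) : Prop where
  pos : ∀ x, 0 < w x
  map_zero : w 0 = 1
  submul : ∀ x y, w (x + y) ≤ w x * w y

/-- An admissible weight function: `w ≥ 1`, and the `k`-th root of `w (k x)` tends to `1` as
`k → ∞`, for every `x`. -/
structure IsAdmissible {M : Type*} [AddCommMonoid M] (w : M → ℝ) : Prop extends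
    IsWeight w where
  one_le : ∀ x, 1 ≤ w x
  tendsto_root : ∀ x, Filter.Tendsto (fun k : ℕ => (w (k • x)) ^ (1 / (k : ℝ)))
    Filter.atTop (nhds 1)

/-- The (underlying set of the) weighted algebra `𝒜_w`: all functions `a : M → ℂ` whose weighted
norm `∑ |a x| w x` is finite. -/
def weightedAlgebra {M : Type*} (w : M → ℝ) : Set (M → ℂ) :=
  {a | Summable fun x => ‖a x‖ * w x}

/-- The general Dirichlet series `ã(s) = ∑ a(l) exp (-l s)`, summed over `l ∈ L`. -/
noncomputable def dirichletSeries {L : AddSubmonoid ℝ} (a : L → ℂ) (s : ℂ) : ℂ :=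
  ∑' l : L, a l * Complex.exp (-((l : ℝ) : ℂ) * s)

/-- The open right half plane. -/
def rightHalfPlane : Set ℂ := {s | 0 < s.re}

end GeneralDirichlet

/-!
A Dirichlet series `ã` is split as `P + b`, where `P` is a Dirichlet polynomial and the remainder
`b` has small weighted norm, and `f` is expanded in a Taylor series around the values of `P`:
`f ∘ ã = ∑ (f⁽ⁿ⁾ ∘ P) / n! * b ^ n`. Since sums and products of absolutely convergent Dirichlet
series are again of this kind, with the obvious bounds on norms, it suffices to control the norms of
`(f⁽ⁿ⁾ ∘ P) / n!` geometrically in `n`. Cauchy's estimate bounds these functions uniformly, so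
everything rests on `exists_isAbsDirichlet_comp_polynomial`: for bounded holomorphic `h`, the norm
of `h ∘ P` is at most a constant independent of `h` times the supremum of `|h|`.

That fact needs neither Kronecker's theorem nor Gelfand theory. Far to the right, `P` is close to
its constant term, and a Taylor expansion there writes `h ∘ P` as a Dirichlet series with
frequencies in the semigroup generated by the finitely many frequencies of `P`. As `h ∘ P` is
bounded and holomorphic slightly to the left of the imaginary axis, Bohr's mean value argument
(`norm_coeff_le_of_bounded`) shows that its coefficients decay exponentially in the frequency. On a
finitely generated semigroup of frequencies an admissible weight grows more slowly than any
exponential, in the summed sense of `IsAdmissible.summable_closure`, so the weighted norm is finite.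
By the identity theorem, the series represents `h ∘ P` on the whole closed half-plane.
-/

namespace GeneralDirichlet

/-! ### Absolutely convergent Dirichlet series with weighted norms -/

section AbsDirichlet

variable {M : Type*} [AddCommMonoid M]

/-- `IsAbsDirichlet φ W D F C` says that on `D` the function `F` is the sum of a Dirichlet series
`∑ c m * exp (-φ m * s)` whose `W`-weighted norm `∑ ‖c m‖ * W m` is finite and at most `C`.  The
frequencies are the values of an additive map `φ`, so that one notion serves both the semigroup
`L` and its finitely generated subsemigroups. -/
def IsAbsDirichlet (φ : M →+ ℝ) (W : M → ℝ) (D : Set ℂ) (F : ℂ → ℂ) (C : ℝ) : Prop :=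
  ∃ c : M → ℂ, Summable (fun m => ‖c m‖ * W m) ∧ ∑' m, ‖c m‖ * W m ≤ C ∧
    ∀ s ∈ D, F s = ∑' m, c m * Complex.exp (-(φ m : ℂ) * s)

variable {φ : M →+ ℝ} {W : M → ℝ} {D : Set ℂ}

/-- A family of exponentials with possibly repeated frequencies may be regrouped: the coefficients
over each fibre of `μ` are added up, which does not increase the weighted norm. -/
theorem IsAbsDirichlet.of_family (hW : IsWeight W)
    (hD : ∀ m, ∀ s ∈ D, ‖Complex.exp (-(φ m : ℂ) * s)‖ ≤ W m)
    {ι : Type*} (c : ι → ℂ) (μ : ι → M) (hc : Summable fun i => ‖c i‖ * W (μ i)) :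
    IsAbsDirichlet φ W D (fun s => ∑' i, c i * Complex.exp (-(φ (μ i) : ℂ) * s))
      (∑' i, ‖c i‖ * W (μ i)) := by
  set e := Equiv.sigmaFiberEquiv μ
  have hs : Summable fun p : (Σ m, {i // μ i = m}) => ‖c p.2‖ * W p.1 := by
    refine ((e.summable_iff).2 hc).congr ?_
    rintro ⟨m, i, rfl⟩
    rfl
  have hfib : ∀ m, Summable fun i : {i // μ i = m} => ‖c i‖ := fun m =>
    (summable_mul_right_iff (hW.pos m).ne').1 (hs.sigma_factor m)
  have hle : ∀ m, ‖∑' i : {i // μ i = m}, c i‖ * W m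
      ≤ ∑' i : {i // μ i = m}, ‖c i‖ * W m := fun m => by
    rw [tsum_mul_right]
    exact mul_le_mul_of_nonneg_right (norm_tsum_le_tsum_norm (hfib m)) (hW.pos m).le
  have hsum : Summable fun m => ‖∑' i : {i // μ i = m}, c i‖ * W m :=
    Summable.of_nonneg_of_le (fun m => mul_nonneg (norm_nonneg _) (hW.pos m).le) hle hs.sigma
  refine ⟨fun m => ∑' i : {i // μ i = m}, c i, hsum, ?_, fun s hsD => ?_⟩
  · refine (hsum.tsum_le_tsum hle hs.sigma).trans_eq ?_
    rw [← hs.tsum_sigma, ← e.tsum_eq]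
    refine tsum_congr ?_
    rintro ⟨m, i, rfl⟩
    rfl
  · have h1 : Summable fun i => c i * Complex.exp (-(φ (μ i) : ℂ) * s) := by
      refine Summable.of_norm_bounded hc fun i => ?_
      rw [norm_mul]
      exact mul_le_mul_of_nonneg_left (hD _ s hsD) (norm_nonneg _)
    have h2 : Summable fun p : (Σ m, {i // μ i = m}) =>
        c p.2 * Complex.exp (-(φ p.1 : ℂ) * s) := by
      refine ((e.summable_iff).2 h1).congr ?_
      rintro ⟨m, i, rfl⟩
      rfl
    simp only [← tsum_mul_right]
    rw [← h2.tsum_sigma, ← e.tsum_eq]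
    refine tsum_congr ?_
    rintro ⟨m, i, rfl⟩
    rfl

theorem IsAbsDirichlet.congr {F F' : ℂ → ℂ} {C C' : ℝ} (h : IsAbsDirichlet φ W D F C)
    (hF : ∀ s ∈ D, F' s = F s) (hC : C ≤ C') : IsAbsDirichlet φ W D F' C' := by
  obtain ⟨c, h1, h2, h3⟩ := h
  exact ⟨c, h1, h2.trans hC, fun s hs => (hF s hs).trans (h3 s hs)⟩

theorem IsAbsDirichlet.const (hW : IsWeight W)
    (hD : ∀ m, ∀ s ∈ D, ‖Complex.exp (-(φ m : ℂ) * s)‖ ≤ W m) (z : ℂ) :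
    IsAbsDirichlet φ W D (fun _ => z) ‖z‖ := by
  have := IsAbsDirichlet.of_family (φ := φ) hW hD (fun _ : Unit => z) (fun _ => 0)
    (Summable.of_finite)
  refine this.congr ?_ ?_ <;> simp [hW.map_zero]

theorem summable_mul_exp (hD : ∀ m, ∀ s ∈ D, ‖Complex.exp (-(φ m : ℂ) * s)‖ ≤ W m)
    {c : M → ℂ} (hc : Summable fun m => ‖c m‖ * W m) {s : ℂ} (hs : s ∈ D) :
    Summable fun m => ‖c m * Complex.exp (-(φ m : ℂ) * s)‖ := by
  refine Summable.of_nonneg_of_le (fun m => norm_nonneg _) (fun m => ?_) hc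
  rw [norm_mul]
  exact mul_le_mul_of_nonneg_left (hD _ s hs) (norm_nonneg _)

theorem IsAbsDirichlet.mul (hW : IsWeight W)
    (hD : ∀ m, ∀ s ∈ D, ‖Complex.exp (-(φ m : ℂ) * s)‖ ≤ W m)
    {F F' : ℂ → ℂ} {C C' : ℝ} (h : IsAbsDirichlet φ W D F C) (h' : IsAbsDirichlet φ W D F' C') :
    IsAbsDirichlet φ W D (fun s => F s * F' s) (C * C') := by
  obtain ⟨c, h1, h2, h3⟩ := h
  obtain ⟨c', h1', h2', h3'⟩ := h'
  have hpos : ∀ (b : M → ℂ) m, 0 ≤ ‖b m‖ * W m := fun b m =>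
    mul_nonneg (norm_nonneg _) (hW.pos m).le
  have hle : ∀ p : M × M, ‖c p.1 * c' p.2‖ * W (p.1 + p.2)
      ≤ (‖c p.1‖ * W p.1) * (‖c' p.2‖ * W p.2) := fun p => by
    rw [norm_mul, mul_mul_mul_comm]
    exact mul_le_mul_of_nonneg_left (hW.submul _ _) (by positivity)
  have hprod := h1.mul_of_nonneg h1' (hpos c) (hpos c')
  have hs : Summable fun p : M × M => ‖c p.1 * c' p.2‖ * W (p.1 + p.2) :=
    Summable.of_nonneg_of_le (fun p => mul_nonneg (norm_nonneg _) (hW.pos _).le) hle hprod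
  refine (IsAbsDirichlet.of_family hW hD (fun p : M × M => c p.1 * c' p.2)
    (fun p => p.1 + p.2) hs).congr (fun s hsD => ?_) ?_
  · rw [h3 s hsD, h3' s hsD, tsum_mul_tsum_of_summable_norm (summable_mul_exp hD h1 hsD)
      (summable_mul_exp hD h1' hsD)]
    refine tsum_congr fun p => ?_
    rw [mul_mul_mul_comm, ← Complex.exp_add]
    congr 2
    push_cast [map_add]
    ring
  · refine (hs.tsum_le_tsum hle hprod).trans ?_
    rw [← h1.tsum_mul_tsum h1' hprod]
    exact mul_le_mul h2 h2' (tsum_nonneg (hpos c')) ((tsum_nonneg (hpos c)).trans h2)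

theorem IsAbsDirichlet.pow (hW : IsWeight W)
    (hD : ∀ m, ∀ s ∈ D, ‖Complex.exp (-(φ m : ℂ) * s)‖ ≤ W m)
    {F : ℂ → ℂ} {C : ℝ} (h : IsAbsDirichlet φ W D F C) (n : ℕ) :
    IsAbsDirichlet φ W D (fun s => F s ^ n) (C ^ n) := by
  induction n with
  | zero => exact (IsAbsDirichlet.const hW hD 1).congr (by simp) (by simp)
  | succ n ih => exact (ih.mul hW hD h).congr (by simp [pow_succ]) (by simp [pow_succ])

theorem IsAbsDirichlet.tsum (hW : IsWeight W)
    (hD : ∀ m, ∀ s ∈ D, ‖Complex.exp (-(φ m : ℂ) * s)‖ ≤ W m)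
    {F : ℕ → ℂ → ℂ} {C : ℕ → ℝ} (h : ∀ n, IsAbsDirichlet φ W D (F n) (C n)) (hC : Summable C) :
    IsAbsDirichlet φ W D (fun s => ∑' n, F n s) (∑' n, C n) := by
  choose c h1 h2 h3 using h
  have hpos : ∀ n m, 0 ≤ ‖c n m‖ * W m := fun n m =>
    mul_nonneg (norm_nonneg _) (hW.pos m).le
  have hC' : Summable fun n => ∑' m, ‖c n m‖ * W m :=
    Summable.of_nonneg_of_le (fun n => tsum_nonneg (hpos n)) h2 hC
  have hs : Summable fun p : ℕ × M => ‖c p.1 p.2‖ * W p.2 :=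
    (summable_prod_of_nonneg fun p => hpos p.1 p.2).2 ⟨h1, hC'⟩
  refine (IsAbsDirichlet.of_family hW hD (fun p : ℕ × M => c p.1 p.2)
    (fun p => p.2) hs).congr (fun s hsD => ?_) ?_
  · have : Summable fun p : ℕ × M => c p.1 p.2 * Complex.exp (-(φ p.2 : ℂ) * s) := by
      refine Summable.of_norm_bounded hs fun p => ?_
      rw [norm_mul]
      exact mul_le_mul_of_nonneg_left (hD _ s hsD) (norm_nonneg _)
    rw [this.tsum_prod]
    exact tsum_congr fun n => h3 n s hsD
  · rw [hs.tsum_prod]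
    exact hC'.tsum_le_tsum h2 hC

end AbsDirichlet

/-! ### Summability over finitely generated semigroups -/

section FinitelyGenerated

variable {M : Type*} [AddCommMonoid M]

/-- A non-negative submultiplicative function that is summable along the multiples of each member
of a finite set is summable over the submonoid which that set generates. -/
theorem summable_closure_of_submul {v : M → ℝ} (h0 : ∀ x, 0 ≤ v x)
    (hv : ∀ x y, v (x + y) ≤ v x * v y) (T : Finset M)
    (hT : ∀ x ∈ T, Summable fun k : ℕ => v (k • x)) :
    Summable fun y : AddSubmonoid.closure (T : Set M) => v y := by
  classical
  induction T using Finset.induction_on with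
  | empty =>
    have : Subsingleton (AddSubmonoid.closure ((∅ : Finset M) : Set M)) := by
      rw [Finset.coe_empty, AddSubmonoid.closure_empty]
      exact ⟨fun x y => Subtype.ext
        ((AddSubmonoid.mem_bot.1 x.2).trans (AddSubmonoid.mem_bot.1 y.2).symm)⟩
    exact Summable.of_finite
  | insert x T _ ih =>
    have ihT := ih fun y hy => hT y (Finset.mem_insert_of_mem hy)
    have hx := hT x (Finset.mem_insert_self x T)
    have hprod := hx.mul_of_nonneg ihT (fun k => h0 _) (fun y => h0 _)
    have hsum : Summable fun p : ℕ × AddSubmonoid.closure (T : Set M) =>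
        v (p.1 • x + p.2) :=
      Summable.of_nonneg_of_le (fun p => h0 _) (fun p => hv _ _) hprod
    have hsec : ∀ y : AddSubmonoid.closure ((insert x T : Finset M) : Set M),
        ∃ p : ℕ × AddSubmonoid.closure (T : Set M), p.1 • x + p.2 = (y : M) := by
      rintro ⟨y, hy⟩
      rw [Finset.coe_insert, Set.insert_eq, AddSubmonoid.closure_union, AddSubmonoid.mem_sup] at hy
      obtain ⟨z, hz, t, ht, rfl⟩ := hy
      obtain ⟨k, rfl⟩ := AddSubmonoid.mem_closure_singleton.1 hz
      exact ⟨(k, ⟨t, ht⟩), rfl⟩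
    choose g hg using hsec
    have hinj : Function.Injective g := fun y z hyz => Subtype.ext (by rw [← hg y, ← hg z, hyz])
    exact (hsum.comp_injective hinj).congr fun y => by simp [hg y]

/-- The root condition on an admissible weight makes it subexponential along multiples. -/
theorem IsAdmissible.summable_exp_mul_nsmul {w : M → ℝ} (hw : IsAdmissible w) {t : ℝ}
    (ht : 0 < t) (x : M) : Summable fun k : ℕ => Real.exp (-t * k) * w (k • x) := by
  have hev : ∀ᶠ k : ℕ in Filter.atTop,
      ‖Real.exp (-t * k) * w (k • x)‖ ≤ 1 * ‖Real.exp (-(t / 2)) ^ k‖ := by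
    filter_upwards [(hw.tendsto_root x).eventually_lt_const
      (Real.one_lt_exp_iff.2 (half_pos ht)), Filter.eventually_gt_atTop 0] with k hk hk0
    have hk0' : (k : ℝ) ≠ 0 := by positivity
    have hwk : w (k • x) ≤ Real.exp (t / 2) ^ k := by
      calc w (k • x) = (w (k • x) ^ (1 / (k : ℝ))) ^ k := by
            rw [← Real.rpow_natCast, ← Real.rpow_mul (hw.pos _).le, one_div_mul_cancel hk0',
              Real.rpow_one]
        _ ≤ _ := pow_le_pow_left₀ (Real.rpow_nonneg (hw.pos _).le _) hk.le k
    rw [one_mul, norm_mul, Real.norm_of_nonneg (Real.exp_pos _).le,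
      Real.norm_of_nonneg (hw.pos _).le, Real.norm_of_nonneg (by positivity)]
    calc Real.exp (-t * k) * w (k • x) ≤ Real.exp (-t * k) * Real.exp (t / 2) ^ k :=
          mul_le_mul_of_nonneg_left hwk (Real.exp_pos _).le
      _ = _ := by
        rw [← Real.exp_nat_mul, ← Real.exp_nat_mul, ← Real.exp_add]
        congr 1
        ring
  refine summable_of_isBigO_nat ?_ (Asymptotics.IsBigO.of_bound 1 hev)
  exact summable_geometric_of_lt_one (Real.exp_pos _).le (by rw [Real.exp_lt_one_iff]; linarith)

/-- Over a finitely generated semigroup of positive frequencies an admissible weight is beaten by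
every decaying exponential. -/
theorem IsAdmissible.summable_closure {w : M → ℝ} (hw : IsAdmissible w) (φ : M →+ ℝ)
    (T : Finset M) (hT : ∀ x ∈ T, 0 < φ x) {t : ℝ} (ht : 0 < t) :
    Summable fun y : AddSubmonoid.closure (T : Set M) => Real.exp (-t * φ y) * w y := by
  refine summable_closure_of_submul (v := fun y => Real.exp (-t * φ y) * w y)
    (fun y => mul_nonneg (Real.exp_pos _).le (hw.pos _).le) (fun x y => ?_) T fun x hx => ?_
  · rw [mul_mul_mul_comm, ← Real.exp_add, map_add, mul_add]
    exact mul_le_mul_of_nonneg_left (hw.submul _ _) (Real.exp_pos _).le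
  · refine (hw.summable_exp_mul_nsmul (mul_pos ht (hT x hx)) x).congr fun k => ?_
    rw [map_nsmul, nsmul_eq_mul]
    congr 2
    ring

end FinitelyGenerated

/-! ### Mean values and Bohr's coefficient estimate -/

section MeanValue

open Filter Topology

theorem norm_mean_exp_le (u : ℝ) {T : ℝ} (hT : 0 < T) :
    ‖((2 * T : ℝ) : ℂ)⁻¹ * ∫ t in (-T)..T, Complex.exp ((u * Complex.I) * t)‖ ≤ 1 := by
  have h := intervalIntegral.norm_integral_le_of_norm_le_const (a := -T) (b := T) (C := 1)
    (f := fun t : ℝ => Complex.exp ((u * Complex.I) * t)) fun t _ => by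
      rw [mul_right_comm, ← Complex.ofReal_mul, Complex.norm_exp_ofReal_mul_I]
  rw [norm_mul, norm_inv, Complex.norm_of_nonneg (by positivity), inv_mul_le_iff₀ (by positivity)]
  rw [abs_of_pos (by linarith)] at h
  linarith

theorem tendsto_mean_exp {u : ℝ} (hu : u ≠ 0) :
    Tendsto (fun T : ℝ => ((2 * T : ℝ) : ℂ)⁻¹ *
      ∫ t in (-T)..T, Complex.exp ((u * Complex.I) * t)) atTop (𝓝 0) := by
  have hc : (u * Complex.I : ℂ) ≠ 0 :=
    mul_ne_zero (Complex.ofReal_ne_zero.2 hu) Complex.I_ne_zero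
  have hn : ∀ t : ℝ, ‖Complex.exp ((u * Complex.I) * t)‖ = 1 := fun t => by
    rw [mul_right_comm, ← Complex.ofReal_mul, Complex.norm_exp_ofReal_mul_I]
  have hlim : Tendsto (fun T : ℝ => T⁻¹ * |u|⁻¹) atTop (𝓝 0) := by
    simpa using tendsto_inv_atTop_zero.mul_const (|u|⁻¹)
  refine squeeze_zero_norm' ?_ hlim
  filter_upwards [eventually_gt_atTop 0] with T hT
  rw [integral_exp_mul_complex hc, norm_mul, norm_inv,
    Complex.norm_of_nonneg (show 0 ≤ 2 * T by positivity), norm_div, norm_mul, Complex.norm_I,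
    mul_one, Complex.norm_real, Real.norm_eq_abs]
  have h2 := norm_sub_le (Complex.exp ((u * Complex.I) * T))
    (Complex.exp ((u * Complex.I) * (-T : ℝ)))
  rw [hn, hn] at h2
  calc (2 * T)⁻¹ * (_ / |u|) ≤ (2 * T)⁻¹ * ((1 + 1) / |u|) := by gcongr
    _ = T⁻¹ * |u|⁻¹ := by
      field_simp
      norm_num

/-- The mean value of an absolutely convergent trigonometric series is its coefficient at
frequency zero. -/
theorem tendsto_mean_tsum {ι : Type*} [Countable ι] {A : ι → ℂ} (hA : Summable fun i => ‖A i‖)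
    (u : ι → ℝ) {i₀ : ι} (h0 : u i₀ = 0) (hne : ∀ i, i ≠ i₀ → u i ≠ 0) :
    Tendsto (fun T : ℝ => ((2 * T : ℝ) : ℂ)⁻¹ *
      ∫ t in (-T)..T, ∑' i, A i * Complex.exp ((u i * Complex.I) * t)) atTop (𝓝 (A i₀)) := by
  classical
  have hn : ∀ (v t : ℝ), ‖Complex.exp ((v * Complex.I) * t)‖ = 1 := fun v t => by
    rw [mul_right_comm, ← Complex.ofReal_mul, Complex.norm_exp_ofReal_mul_I]
  have hswap : ∀ T : ℝ, ((2 * T : ℝ) : ℂ)⁻¹ *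
      ∫ t in (-T)..T, ∑' i, A i * Complex.exp ((u i * Complex.I) * t)
      = ∑' i, A i * (((2 * T : ℝ) : ℂ)⁻¹ *
        ∫ t in (-T)..T, Complex.exp ((u i * Complex.I) * t)) := fun T => by
    have := intervalIntegral.hasSum_integral_of_dominated_convergence
      (μ := MeasureTheory.volume) (a := -T) (b := T)
      (F := fun i (t : ℝ) => A i * Complex.exp ((u i * Complex.I) * t))
      (f := fun t : ℝ => ∑' i, A i * Complex.exp ((u i * Complex.I) * t))
      (fun i _ => ‖A i‖) (fun i => Continuous.aestronglyMeasurable (by fun_prop))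
      (fun i => Eventually.of_forall fun t _ => by rw [norm_mul, hn, mul_one])
      (Eventually.of_forall fun t _ => hA) intervalIntegrable_const
      (Eventually.of_forall fun t _ => Summable.hasSum <| Summable.of_norm <|
        hA.congr fun i => by rw [norm_mul, hn, mul_one])
    rw [← this.tsum_eq, ← tsum_mul_left]
    refine tsum_congr fun i => ?_
    rw [intervalIntegral.integral_const_mul]
    ring
  simp only [hswap]
  have key := tendsto_tsum_of_dominated_convergence (𝓕 := (atTop : Filter ℝ))
    (f := fun T i => A i * (((2 * T : ℝ) : ℂ)⁻¹ *
        ∫ t in (-T)..T, Complex.exp ((u i * Complex.I) * t)))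
    (g := fun i => if i = i₀ then A i₀ else 0) (bound := fun i => ‖A i‖) hA ?_ ?_
  · simpa using key
  · intro i
    by_cases hi : i = i₀
    · subst hi
      refine Tendsto.congr' ?_ tendsto_const_nhds
      filter_upwards [eventually_gt_atTop 0] with T hT
      have hT' : (T : ℂ) ≠ 0 := Complex.ofReal_ne_zero.2 hT.ne'
      simp only [h0, if_true, Complex.ofReal_zero, zero_mul, Complex.exp_zero,
        intervalIntegral.integral_const]
      rw [Complex.real_smul]
      push_cast
      field_simp
      ring
    · simpa [hi] using (tendsto_mean_exp (hne i hi)).const_mul (A i)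
  · filter_upwards [eventually_gt_atTop 0] with T hT i
    rw [norm_mul]
    exact mul_le_of_le_one_right (norm_nonneg _) (norm_mean_exp_le _ hT)

/-- By Cauchy's theorem, the integrals of a bounded holomorphic function over two vertical segments
of the same height differ by an amount independent of that height. -/
theorem norm_integral_vertical_sub_le {g : ℂ → ℂ} {x y B : ℝ} (hxy : x ≤ y)
    (hg : DifferentiableOn ℂ g {s | x ≤ s.re ∧ s.re ≤ y})
    (hB : ∀ s : ℂ, x ≤ s.re → s.re ≤ y → ‖g s‖ ≤ B) (T : ℝ) :
    ‖(∫ t in (-T)..T, g (y + t * Complex.I)) - ∫ t in (-T)..T, g (x + t * Complex.I)‖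
      ≤ 2 * B * (y - x) := by
  have hrect := Complex.integral_boundary_rect_eq_zero_of_differentiableOn g
    (x + (-T : ℝ) * Complex.I) (y + T * Complex.I) (hg.mono fun s hs => by
      have := (Complex.mem_reProdIm.1 hs).1
      simpa [Set.uIcc_of_le hxy] using this)
  simp only [Complex.add_re, Complex.add_im, Complex.mul_re, Complex.mul_im, Complex.ofReal_re,
    Complex.ofReal_im, Complex.I_re, Complex.I_im, mul_zero, mul_one, sub_zero, zero_add,
    add_zero] at hrect
  have hbd : ∀ τ : ℝ, ‖∫ r in x..y, g (r + τ * Complex.I)‖ ≤ B * (y - x) := fun τ => by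
    have := intervalIntegral.norm_integral_le_of_norm_le_const (a := x) (b := y) (C := B)
      (f := fun r : ℝ => g (r + τ * Complex.I)) fun r hr => by
        rw [Set.uIoc_of_le hxy] at hr
        exact hB _ (by simpa using hr.1.le) (by simpa using hr.2)
    rwa [abs_of_nonneg (by linarith)] at this
  have heq : Complex.I * ((∫ t in (-T)..T, g (y + t * Complex.I))
      - ∫ t in (-T)..T, g (x + t * Complex.I))
      = (∫ r in x..y, g (r + T * Complex.I)) - ∫ r in x..y, g (r + (-T : ℝ) * Complex.I) := by
    simp only [smul_eq_mul] at hrect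
    linear_combination hrect
  calc _ = ‖Complex.I * ((∫ t in (-T)..T, g (y + t * Complex.I))
      - ∫ t in (-T)..T, g (x + t * Complex.I))‖ := by rw [norm_mul, Complex.norm_I, one_mul]
    _ ≤ B * (y - x) + B * (y - x) := by
      rw [heq]
      exact (norm_sub_le _ _).trans (add_le_add (hbd _) (hbd _))
    _ = _ := by ring

/-- **Bohr's coefficient estimate**: if a function bounded by `B` and holomorphic on a half-plane is
the sum of an absolutely convergent Dirichlet series far to the right, then the coefficients are
controlled by `B` on every vertical line of the half-plane. The coefficient is a mean value over a
line far to the right, and Cauchy's theorem moves that line. -/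
theorem norm_coeff_le_of_bounded {M : Type*} [AddCommMonoid M] [Countable M] {φ : M →+ ℝ}
    (hφ : Function.Injective φ) (hφ0 : ∀ m, 0 ≤ φ m) {F : ℂ → ℂ} {x y B : ℝ} (hxy : x ≤ y)
    (hF : DifferentiableOn ℂ F {s | x ≤ s.re}) (hB : ∀ s : ℂ, x ≤ s.re → ‖F s‖ ≤ B)
    {c : M → ℂ} (hc : Summable fun m => ‖c m‖ * Real.exp (-φ m * y))
    (hFc : ∀ s : ℂ, s.re = y → F s = ∑' m, c m * Complex.exp (-(φ m : ℂ) * s)) (m : M) :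
    ‖c m‖ ≤ B * Real.exp (φ m * x) := by
  have hB0 : 0 ≤ B := (norm_nonneg _).trans (hB x (by simp))
  set g : ℂ → ℂ := fun s => F s * Complex.exp (φ m * s) with hg
  set A : M → ℂ := fun k => c k * Complex.exp (((φ m - φ k) * y : ℝ)) with hA
  have hA' : Summable fun k => ‖A k‖ := by
    refine (hc.mul_right (Real.exp (φ m * y))).congr fun k => ?_
    rw [hA, norm_mul, Complex.norm_exp, Complex.ofReal_re, mul_assoc, ← Real.exp_add]
    ring_nf
  have hmean := tendsto_mean_tsum hA' (fun k => φ m - φ k) (sub_self (φ m))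
    fun k hk h => hk (hφ (sub_eq_zero.1 h).symm)
  have hAm : A m = c m := by simp [hA]
  have hgA : ∀ t : ℝ, g (y + t * Complex.I)
      = ∑' k, A k * Complex.exp (((φ m - φ k : ℝ) * Complex.I) * t) := fun t => by
    simp only [hg]
    rw [hFc _ (by simp), ← tsum_mul_right]
    refine tsum_congr fun k => ?_
    rw [hA, mul_assoc, mul_assoc, ← Complex.exp_add, ← Complex.exp_add]
    congr 2
    push_cast
    ring
  simp only [← hgA, hAm] at hmean
  have hgn : ∀ s : ℂ, x ≤ s.re → ‖g s‖ ≤ B * Real.exp (φ m * s.re) := fun s hs => by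
    rw [hg, norm_mul, Complex.norm_exp, Complex.re_ofReal_mul]
    exact mul_le_mul_of_nonneg_right (hB s hs) (Real.exp_pos _).le
  have hsub := norm_integral_vertical_sub_le hxy (g := g) (B := B * Real.exp (φ m * y))
    ((hF.mono fun s hs => hs.1).mul (by fun_prop)) fun s h1 h2 => (hgn s h1).trans <| by
      have := hφ0 m
      gcongr
  have hleft : ∀ T : ℝ, 0 < T →
      ‖∫ t in (-T)..T, g (x + t * Complex.I)‖ ≤ B * Real.exp (φ m * x) * (2 * T) := fun T hT => by
    have := intervalIntegral.norm_integral_le_of_norm_le_const (a := -T) (b := T)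
      (C := B * Real.exp (φ m * x)) (f := fun t : ℝ => g (x + t * Complex.I)) fun t _ => by
        have := hgn (x + t * Complex.I) (by simp)
        simpa using this
    rwa [abs_of_pos (by linarith), sub_neg_eq_add, ← two_mul] at this
  have hlim : Tendsto (fun T : ℝ => T⁻¹ * (B * Real.exp (φ m * y) * (y - x))
      + B * Real.exp (φ m * x)) atTop (𝓝 (B * Real.exp (φ m * x))) := by
    simpa using (tendsto_inv_atTop_zero.mul_const (B * Real.exp (φ m * y) * (y - x))).add_const
      (B * Real.exp (φ m * x))
  refine le_of_tendsto_of_tendsto hmean.norm hlim ?_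
  filter_upwards [eventually_gt_atTop 0] with T hT
  rw [norm_mul, norm_inv, Complex.norm_of_nonneg (by positivity), inv_mul_le_iff₀ (by positivity)]
  have h3 := norm_le_norm_add_norm_sub' (∫ t in (-T)..T, g (y + t * Complex.I))
    (∫ t in (-T)..T, g (x + t * Complex.I))
  refine h3.trans ((add_le_add (hleft T hT) (hsub T)).trans_eq ?_)
  field_simp
  ring

end MeanValue

/-! ### Composition of holomorphic functions with Dirichlet polynomials -/

section Composition

open Filter Topology

/-- Taylor expansion of a bounded holomorphic function, with Cauchy's bound on the coefficients. -/
theorem taylor_of_bounded {h : ℂ → ℂ} {z : ℂ} {R B : ℝ} (hR : 0 < R)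
    (hd : DifferentiableOn ℂ h (Metric.closedBall z R))
    (hB : ∀ x ∈ Metric.closedBall z R, ‖h x‖ ≤ B) :
    (∀ n : ℕ, ‖(n.factorial : ℂ)⁻¹ * iteratedDeriv n h z‖ ≤ B / R ^ n) ∧
      ∀ u : ℂ, ‖u‖ < R → h (z + u) = ∑' n : ℕ, (n.factorial : ℂ)⁻¹ * iteratedDeriv n h z * u ^ n := by
  refine ⟨fun n => ?_, fun u hu => ?_⟩
  · have := Complex.norm_iteratedDeriv_le_of_forall_mem_sphere_norm_le n hR
      (hd.diffContOnCl_ball subset_rfl) fun x hx => hB x (Metric.sphere_subset_closedBall hx)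
    have hn : (0 : ℝ) < n.factorial := by positivity
    rw [norm_mul, norm_inv, Complex.norm_natCast, inv_mul_le_iff₀ hn]
    rwa [← mul_div_assoc]
  · have := Complex.taylorSeries_eq_on_ball' (z := z + u) (by simpa using hu)
      (hd.mono Metric.ball_subset_closedBall)
    simpa using this.symm

variable {M : Type*} [AddCommMonoid M] {φ : M →+ ℝ}

theorem isWeight_exp (φ : M →+ ℝ) (σ : ℝ) : IsWeight fun m => Real.exp (-φ m * σ) where
  pos _ := Real.exp_pos _
  map_zero := by simp
  submul x y := by
    rw [← Real.exp_add, map_add]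
    exact (congrArg Real.exp (by ring)).le

theorem norm_exp_le_exp (hφ0 : ∀ m, 0 ≤ φ m) {σ : ℝ} (m : M) {s : ℂ} (hs : σ ≤ s.re) :
    ‖Complex.exp (-(φ m : ℂ) * s)‖ ≤ Real.exp (-φ m * σ) := by
  rw [Complex.norm_exp, ← Complex.ofReal_neg, Complex.re_ofReal_mul]
  exact Real.exp_le_exp.2 (mul_le_mul_of_nonpos_left hs (neg_nonpos.2 (hφ0 m)))

/-- Let `P` be a Dirichlet polynomial whose values on a half-plane `-ε < Re s` stay well inside an
open set `V`. Then `h ∘ P` is an absolutely convergent Dirichlet series for every bounded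
holomorphic `h` on `V`, and its weighted norm is at most a constant times the bound on `h`, where
the constant does not depend on `h`.

Far to the right the Taylor series of `h` at the constant term of `P` produces the series, with
frequencies in the semigroup generated by those of `P`. Bohr's estimate makes its coefficients
decay exponentially, which on a finitely generated semigroup beats the weight. -/
theorem exists_isAbsDirichlet_comp_polynomial (hφ : Function.Injective φ) (hφ0 : ∀ m, 0 ≤ φ m)
    {w : M → ℝ} (hw : IsAdmissible w) (S : Finset M) (a : M → ℂ) {ε : ℝ} (hε : 0 < ε)
    {V : Set ℂ} (hV : IsOpen V)
    (hPV : closure ((fun s : ℂ => ∑ m ∈ S, a m * Complex.exp (-(φ m : ℂ) * s)) ''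
      {s | -ε < s.re}) ⊆ V) :
    ∃ C : ℝ, ∀ (h : ℂ → ℂ) (B : ℝ), DifferentiableOn ℂ h V → (∀ z ∈ V, ‖h z‖ ≤ B) →
      IsAbsDirichlet φ w {s | 0 ≤ s.re}
        (fun s => h (∑ m ∈ S, a m * Complex.exp (-(φ m : ℂ) * s))) (C * B) := by
  classical
  set P : ℂ → ℂ := fun s => ∑ m ∈ S, a m * Complex.exp (-(φ m : ℂ) * s) with hP
  set T := S.filter (· ≠ 0) with hT
  set P₀ : ℂ := ∑ m ∈ S with m = 0, a m with hP₀
  set Q : ℂ → ℂ := fun s => ∑ m ∈ T, a m * Complex.exp (-(φ m : ℂ) * s) with hQ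
  have hPQ : ∀ s, P s = P₀ + Q s := fun s => by
    rw [hP, hP₀, hQ, hT]
    simp only
    rw [← Finset.sum_filter_add_sum_filter_not S (· = 0)]
    congr 1
    refine Finset.sum_congr rfl fun m hm => ?_
    simp [(Finset.mem_filter.1 hm).2]
  have hTpos : ∀ m ∈ T, 0 < φ m := fun m hm =>
    (hφ0 m).lt_of_ne fun h => (Finset.mem_filter.1 hm).2 (hφ (by rw [← h, map_zero]))
  set q : ℝ → ℝ := fun σ => ∑ m ∈ T, ‖a m‖ * Real.exp (-φ m * σ) with hq
  have hq0 : ∀ σ, 0 ≤ q σ := fun σ =>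
    Finset.sum_nonneg fun m _ => mul_nonneg (norm_nonneg _) (Real.exp_pos _).le
  have hQq : ∀ (σ : ℝ) (s : ℂ), σ ≤ s.re → ‖Q s‖ ≤ q σ := fun σ s hs =>
    norm_sum_le_of_le _ fun m _ => by
      rw [norm_mul]
      exact mul_le_mul_of_nonneg_left (norm_exp_le_exp hφ0 m hs) (norm_nonneg _)
  have hqlim : Tendsto q atTop (𝓝 0) := by
    have : Tendsto q atTop (𝓝 (∑ m ∈ T, ‖a m‖ * 0)) := by
      refine tendsto_finsetSum _ fun m hm => Tendsto.const_mul _ ?_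
      exact Real.tendsto_exp_atBot.comp
        (tendsto_id.const_mul_atTop_of_neg (neg_neg_of_pos (hTpos m hm)))
    simpa using this
  have hP₀V : P₀ ∈ V := by
    refine hPV (mem_closure_of_tendsto (f := fun σ : ℝ => P σ) (b := atTop) ?_ ?_)
    · refine tendsto_iff_norm_sub_tendsto_zero.2 (squeeze_zero (fun _ => norm_nonneg _)
        (fun σ => ?_) hqlim)
      rw [hPQ, add_sub_cancel_left]
      exact hQq σ σ (by simp)
    · filter_upwards [eventually_ge_atTop 0] with σ hσ
      exact ⟨σ, by simpa using lt_of_lt_of_le (neg_neg_of_pos hε) hσ, rfl⟩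
  obtain ⟨r, hr, hrV⟩ := Metric.nhds_basis_closedBall.mem_iff.1 (hV.mem_nhds hP₀V)
  obtain ⟨σ, hσq, hσ0⟩ := ((hqlim.eventually_lt_const hr).and (eventually_ge_atTop 0)).exists
  set N := AddSubmonoid.closure (T : Set M) with hN
  set ψ : N →+ ℝ := φ.comp N.subtype with hψ
  have hψ0 : ∀ n, 0 ≤ ψ n := fun n => hφ0 n
  have hsum : ∀ {t : ℝ}, 0 < t → Summable fun n : N => Real.exp (-t * ψ n) * w n := fun ht =>
    hw.summable_closure φ T hTpos ht
  have : Countable N := by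
    have := (hsum one_pos).countable_support
    rwa [Function.support_eq_univ fun n => (mul_pos (Real.exp_pos _) (hw.pos _)).ne',
      Set.countable_univ_iff] at this
  have hDσ : ∀ n : N, ∀ s ∈ {s : ℂ | σ ≤ s.re},
      ‖Complex.exp (-(ψ n : ℂ) * s)‖ ≤ Real.exp (-ψ n * σ) := fun n s hs =>
    norm_exp_le_exp hψ0 n hs
  have hWσ := isWeight_exp ψ σ
  have hQN : IsAbsDirichlet ψ (fun n => Real.exp (-ψ n * σ)) {s | σ ≤ s.re} Q (q σ) := by
    refine (IsAbsDirichlet.of_family hWσ hDσ (fun m : T => a m)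
      (fun m => ⟨m, AddSubmonoid.subset_closure m.2⟩) Summable.of_finite).congr
      (fun s _ => ?_) ?_
    · rw [tsum_fintype]
      exact (Finset.sum_coe_sort T fun m => a m * Complex.exp (-(φ m : ℂ) * s)).symm
    · rw [tsum_fintype]
      exact (Finset.sum_coe_sort T fun m => ‖a m‖ * Real.exp (-φ m * σ)).le
  have hPdiff : Differentiable ℂ P := by
    rw [hP]
    fun_prop
  have hPmem : ∀ s : ℂ, -ε < s.re → P s ∈ V := fun s hs =>
    hPV (subset_closure ⟨s, hs, rfl⟩)
  refine ⟨∑' n : N, Real.exp (-(ε / 2) * ψ n) * w n, fun h B hh hB => ?_⟩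
  have hB0 : 0 ≤ B := (norm_nonneg _).trans (hB _ hP₀V)
  obtain ⟨hk, htaylor⟩ := taylor_of_bounded hr (hh.mono hrV) fun x hx => hB x (hrV hx)
  set k : ℕ → ℂ := fun n => (n.factorial : ℂ)⁻¹ * iteratedDeriv n h P₀ with hkdef
  have hksum : Summable fun n => ‖k n‖ * q σ ^ n := by
    refine Summable.of_nonneg_of_le (fun n => mul_nonneg (norm_nonneg _) (pow_nonneg (hq0 _) _))
      (fun n => (mul_le_mul_of_nonneg_right (hk n) (pow_nonneg (hq0 _) _)).trans_eq
        (show _ = B * (q σ / r) ^ n by rw [div_pow]; ring)) ?_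
    exact (summable_geometric_of_lt_one (div_nonneg (hq0 _) hr.le)
      ((div_lt_one hr).2 hσq)).mul_left B
  obtain ⟨c, hc1, -, hc3⟩ : IsAbsDirichlet ψ (fun n => Real.exp (-ψ n * σ)) {s | σ ≤ s.re}
      (fun s => h (P s)) (∑' n, ‖k n‖ * q σ ^ n) := by
    refine (IsAbsDirichlet.tsum hWσ hDσ (fun n => (IsAbsDirichlet.const hWσ hDσ (k n)).mul hWσ hDσ
      (hQN.pow hWσ hDσ n)) hksum).congr (fun s hs => ?_) le_rfl
    rw [hPQ, htaylor _ ((hQq σ s hs).trans_lt hσq)]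
  have hcoef : ∀ n, ‖c n‖ ≤ B * Real.exp (ψ n * -(ε / 2)) := by
    refine norm_coeff_le_of_bounded (F := fun s => h (P s)) (y := σ)
      (fun x y hxy => Subtype.ext (hφ hxy)) hψ0 (by linarith) ?_ ?_ hc1 fun s hs => hc3 s hs.ge
    · exact hh.comp hPdiff.differentiableOn fun s (hs : -(ε / 2) ≤ s.re) =>
        hPmem s (by linarith)
    · exact fun s hs => hB _ (hPmem s (by linarith))
  -- The coefficient bound makes the series holomorphic slightly to the left of the imaginary axis,
  -- so that the identity far to the right persists there.
  have hident : Set.EqOn (fun s => h (P s)) (fun s => ∑' n, c n * Complex.exp (-(ψ n : ℂ) * s))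
      {s | -(ε / 4) < s.re} := by
    have hopen : IsOpen {s : ℂ | -(ε / 4) < s.re} := isOpen_lt continuous_const Complex.continuous_re
    have hu : Summable fun n : N => B * Real.exp (-(ε / 4) * ψ n) := by
      refine Summable.mul_left B (Summable.of_nonneg_of_le (fun _ => (Real.exp_pos _).le)
        (fun n => ?_) (hsum (t := ε / 4) (by positivity)))
      exact le_mul_of_one_le_right (Real.exp_pos _).le (hw.one_le _)
    have h1 : DifferentiableOn ℂ (fun s => h (P s)) {s | -(ε / 4) < s.re} :=
      hh.comp hPdiff.differentiableOn fun s (hs : -(ε / 4) < s.re) => hPmem s (by linarith)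
    have h2 : DifferentiableOn ℂ (fun s => ∑' n, c n * Complex.exp (-(ψ n : ℂ) * s))
        {s | -(ε / 4) < s.re} := by
      refine Complex.differentiableOn_tsum_of_summable_norm hu
        (fun n => by fun_prop) hopen fun n s hs => ?_
      rw [norm_mul]
      refine (mul_le_mul (hcoef n) (norm_exp_le_exp hψ0 n (le_of_lt hs)) (norm_nonneg _)
        (mul_nonneg hB0 (Real.exp_pos _).le)).trans_eq ?_
      rw [mul_assoc, ← Real.exp_add]
      congr 2
      ring
    refine (h1.analyticOnNhd hopen).eqOn_of_preconnected_of_eventuallyEq (h2.analyticOnNhd hopen)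
      (convex_halfSpace_re_gt _).isPreconnected (z₀ := ((σ + 1 : ℝ) : ℂ)) ?_ ?_
    · simp only [Set.mem_ofPred_eq, Complex.ofReal_re]
      linarith
    · filter_upwards [(isOpen_lt continuous_const Complex.continuous_re).mem_nhds
        (show σ < ((σ + 1 : ℝ) : ℂ).re by simp)] with s hs
      exact hc3 s (le_of_lt hs)
  have hle : ∀ n : N, ‖c n‖ * w n ≤ B * (Real.exp (-(ε / 2) * ψ n) * w n) := fun n => by
    rw [← mul_assoc, mul_comm (-(ε / 2))]
    exact mul_le_mul_of_nonneg_right (hcoef n) (hw.pos _).le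
  have hs2 := (hsum (t := ε / 2) (by positivity)).mul_left B
  have hcw : Summable fun n : N => ‖c n‖ * w n :=
    Summable.of_nonneg_of_le (fun n => mul_nonneg (norm_nonneg _) (hw.pos _).le) hle hs2
  refine (IsAbsDirichlet.of_family (φ := φ) hw.toIsWeight (fun m s hs => ?_) c
    (fun n : N => (n : M)) hcw).congr (fun s hs => ?_) ?_
  · exact (norm_exp_le_exp hφ0 m hs).trans (by simpa using hw.one_le m)
  · exact hident (show -(ε / 4) < s.re from lt_of_lt_of_le (by linarith) hs)
  · refine (hcw.tsum_le_tsum hle hs2).trans_eq ?_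
    rw [tsum_mul_left, mul_comm]

end Composition

end GeneralDirichlet

/-! ### The Wiener–Lévy theorem -/

theorem theorem3 (L : AddSubmonoid ℝ) (hL : ∀ l ∈ L, 0 ≤ l)
    (G : Set ℂ) (hGo : IsOpen G) (hGc : IsConnected G)
    (f : ℂ → ℂ) (hf : DifferentiableOn ℂ f G)
    (w : L → ℝ) (hw : GeneralDirichlet.IsAdmissible w)
    (a : L → ℂ) (ha : a ∈ GeneralDirichlet.weightedAlgebra w)
    (haG : closure (GeneralDirichlet.dirichletSeries a '' GeneralDirichlet.rightHalfPlane) ⊆ G) :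
    ∃ c ∈ GeneralDirichlet.weightedAlgebra w,
      ∀ s ∈ closure GeneralDirichlet.rightHalfPlane,
        f (GeneralDirichlet.dirichletSeries a s) = GeneralDirichlet.dirichletSeries c s := by
  classical
  set φ : L →+ ℝ := L.subtype with hφdef
  have hφ : Function.Injective φ := Subtype.val_injective
  have hφ0 : ∀ l, 0 ≤ φ l := fun l => hL l l.2
  have hD : ∀ l, ∀ s ∈ {s : ℂ | 0 ≤ s.re}, ‖Complex.exp (-(φ l : ℂ) * s)‖ ≤ w l := fun l s hs =>
    (GeneralDirichlet.norm_exp_le_exp hφ0 l hs).trans (by simpa using hw.one_le l)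
  have haw : Summable fun l => ‖a l‖ * w l := ha
  set A : ℂ → ℂ := fun s => ∑' l, a l * Complex.exp (-(φ l : ℂ) * s) with hA
  set K := closure (A '' GeneralDirichlet.rightHalfPlane) with hK
  have hKG : K ⊆ G := haG
  have hKc : IsCompact K := by
    refine Metric.isCompact_of_isClosed_isBounded isClosed_closure (Bornology.IsBounded.closure ?_)
    refine isBounded_iff_forall_norm_le.2 ⟨∑' l, ‖a l‖ * w l, ?_⟩
    rintro _ ⟨s, hs, rfl⟩
    have hs' : 0 < s.re := hs
    refine tsum_of_norm_bounded haw.hasSum fun l => ?_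
    rw [norm_mul]
    exact mul_le_mul_of_nonneg_left (hD l s hs'.le) (norm_nonneg _)
  obtain ⟨δ, hδ, hδG⟩ := hKc.exists_cthickening_subset_open hGo hKG
  obtain ⟨B, hB⟩ := hKc.cthickening.exists_bound_of_continuousOn (hf.continuousOn.mono hδG)
  set V := Metric.thickening (δ / 2) K with hVdef
  have hball : ∀ z ∈ V, Metric.closedBall z (δ / 2) ⊆ Metric.cthickening δ K := fun z hz y hy => by
    obtain ⟨x, hx, hzx⟩ := Metric.mem_thickening_iff.1 hz
    refine Metric.mem_cthickening_of_dist_le y x δ K hx ?_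
    have := dist_triangle y z x
    have := Metric.mem_closedBall.1 hy
    linarith
  have hVG : V ⊆ G := fun z hz =>
    hδG (hball z hz (Metric.mem_closedBall_self (by positivity)))
  have htaylor := fun z hz => GeneralDirichlet.taylor_of_bounded (half_pos hδ)
    (hf.mono ((hball z hz).trans hδG)) fun x hx => hB x (hball z hz hx)
  set g : ℕ → ℂ → ℂ := fun n z => (n.factorial : ℂ)⁻¹ * iteratedDeriv n f z with hg
  have hgd : ∀ n, DifferentiableOn ℂ (g n) V := fun n => by
    refine DifferentiableOn.const_mul ?_ _
    rw [iteratedDeriv_eq_iterate]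
    exact (((hf.analyticOnNhd hGo).iterated_deriv n).mono hVG).differentiableOn
  -- Split `A` into a Dirichlet polynomial `P` and a remainder `b` of weighted norm below `δ / 4`.
  obtain ⟨S, hS⟩ := ((tendsto_tsum_compl_atTop_zero fun l => ‖a l‖ * w l).eventually_lt_const
    (show (0 : ℝ) < δ / 4 by positivity)).exists
  set P : ℂ → ℂ := fun s => ∑ l ∈ S, a l * Complex.exp (-(φ l : ℂ) * s) with hP
  set b : ℂ → ℂ := fun s =>
    ∑' l : {l // l ∉ S}, a l * Complex.exp (-(φ (l : L) : ℂ) * s) with hb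
  have hbsum : Summable fun l : {l // l ∉ S} => ‖a l‖ * w l :=
    haw.comp_injective Subtype.val_injective
  have hbA : GeneralDirichlet.IsAbsDirichlet φ w {s | 0 ≤ s.re} b (δ / 4) :=
    (GeneralDirichlet.IsAbsDirichlet.of_family hw.toIsWeight hD (fun l : {l // l ∉ S} => a l)
      (fun l => l) hbsum).congr (fun _ _ => rfl) hS.le
  have hbn : ∀ s : ℂ, 0 ≤ s.re → ‖b s‖ ≤ δ / 4 := fun s hs => by
    refine (tsum_of_norm_bounded hbsum.hasSum fun l => ?_).trans hS.le
    rw [norm_mul]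
    exact mul_le_mul_of_nonneg_left (hD l s hs) (norm_nonneg _)
  have hAPb : ∀ s : ℂ, 0 ≤ s.re → A s = P s + b s := fun s hs =>
    ((GeneralDirichlet.summable_mul_exp hD haw hs).of_norm.sum_add_tsum_subtype_compl S).symm
  -- The oscillation of `P` under a horizontal shift by `2 * ε` tends to zero with `ε`.
  obtain ⟨ε, hεδ, hε⟩ : ∃ ε : ℝ,
      ∑ l ∈ S, ‖a l‖ * (Real.exp (φ l * ε) - Real.exp (-φ l * ε)) < δ / 8 ∧ 0 < ε := by
    have hcont : Continuous fun ε : ℝ =>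
        ∑ l ∈ S, ‖a l‖ * (Real.exp (φ l * ε) - Real.exp (-φ l * ε)) := by fun_prop
    have h0 := (hcont.tendsto 0).mono_left (nhdsWithin_le_nhds (s := Set.Ioi 0))
    simp only [mul_zero, sub_self, Finset.sum_const_zero] at h0
    exact ((h0.eventually_lt_const (show (0 : ℝ) < δ / 8 by positivity)).and
      self_mem_nhdsWithin).exists
  have hPshift : ∀ s : ℂ, -ε < s.re → ‖P s - P (s + (2 * ε : ℝ))‖ ≤ δ / 8 := fun s hs => by
    rw [hP]
    simp only
    rw [← Finset.sum_sub_distrib]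
    refine (norm_sum_le_of_le _ fun l _ => ?_).trans hεδ.le
    have h1 : Complex.exp (-(φ l : ℂ) * (s + (2 * ε : ℝ)))
        = Complex.exp (-(φ l : ℂ) * s) * (Real.exp (-φ l * (2 * ε)) : ℝ) := by
      rw [Complex.ofReal_exp, ← Complex.exp_add]
      congr 1
      push_cast
      ring
    have h2 : (0 : ℝ) ≤ 1 - Real.exp (-φ l * (2 * ε)) := by
      rw [sub_nonneg, Real.exp_le_one_iff]
      have := mul_nonneg (hφ0 l) hε.le
      linarith
    rw [← mul_sub, norm_mul, h1]
    refine mul_le_mul_of_nonneg_left ?_ (norm_nonneg _)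
    calc ‖Complex.exp (-(φ l : ℂ) * s)
          - Complex.exp (-(φ l : ℂ) * s) * (Real.exp (-φ l * (2 * ε)) : ℝ)‖
        = ‖Complex.exp (-(φ l : ℂ) * s) * ((1 - Real.exp (-φ l * (2 * ε)) : ℝ) : ℂ)‖ := by
          congr 1
          push_cast
          ring
      _ = ‖Complex.exp (-(φ l : ℂ) * s)‖ * (1 - Real.exp (-φ l * (2 * ε))) := by
          rw [norm_mul, Complex.norm_of_nonneg h2]
      _ ≤ Real.exp (-φ l * -ε) * (1 - Real.exp (-φ l * (2 * ε))) :=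
          mul_le_mul_of_nonneg_right (GeneralDirichlet.norm_exp_le_exp hφ0 l hs.le) h2
      _ = _ := by
          rw [mul_sub, mul_one, ← Real.exp_add]
          congr 2 <;> ring
  have hPV : closure (P '' {s | -ε < s.re}) ⊆ V := by
    refine (closure_minimal ?_ Metric.isClosed_cthickening).trans
      (Metric.cthickening_subset_thickening' (half_pos hδ)
        (show 3 * δ / 8 < δ / 2 by linarith) K)
    rintro _ ⟨s, hs, rfl⟩
    have hs' : 0 < (s + (2 * ε : ℝ)).re := by
      have : -ε < s.re := hs
      rw [Complex.add_re, Complex.ofReal_re]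
      linarith
    refine Metric.mem_cthickening_of_dist_le _ (A (s + (2 * ε : ℝ))) _ K
      (subset_closure ⟨_, hs', rfl⟩) ?_
    rw [dist_eq_norm, hAPb _ hs'.le, ← sub_sub]
    refine (norm_sub_le _ _).trans ?_
    have := hPshift s hs
    have := hbn _ hs'.le
    linarith
  have hPmem : ∀ s : ℂ, 0 ≤ s.re → P s ∈ V := fun s hs =>
    hPV (subset_closure ⟨s, show -ε < s.re by linarith, rfl⟩)
  obtain ⟨C, hC⟩ := GeneralDirichlet.exists_isAbsDirichlet_comp_polynomial hφ hφ0 hw S a hε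
    Metric.isOpen_thickening hPV
  have hterm : ∀ n, GeneralDirichlet.IsAbsDirichlet φ w {s | 0 ≤ s.re}
      (fun s => g n (P s) * b s ^ n) (C * (B / (δ / 2) ^ n) * (δ / 4) ^ n) := fun n =>
    (hC (g n) (B / (δ / 2) ^ n) (hgd n) fun z hz => (htaylor z hz).1 n).mul hw.toIsWeight hD
      (hbA.pow hw.toIsWeight hD n)
  have hsum : Summable fun n : ℕ => C * (B / (δ / 2) ^ n) * (δ / 4) ^ n := by
    refine (summable_geometric_two.mul_left (C * B)).congr fun n => ?_
    have : (1 / 2 : ℝ) = (δ / 4) / (δ / 2) := by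
      field_simp
      norm_num
    rw [this, div_pow]
    ring
  obtain ⟨c, hc, -, hfc⟩ := GeneralDirichlet.IsAbsDirichlet.tsum hw.toIsWeight hD hterm hsum
  refine ⟨c, hc, fun s hs => ?_⟩
  have hs0 : 0 ≤ s.re := by
    have : s ∈ closure {s : ℂ | 0 < s.re} := hs
    rwa [Complex.closure_setOfPred_lt_re] at this
  change f (A s) = ∑' l, c l * Complex.exp (-(φ l : ℂ) * s)
  rw [← hfc s hs0, hAPb s hs0]
  exact (htaylor (P s) (hPmem s hs0)).2 (b s) ((hbn s hs0).trans_lt (by linarith))
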